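/- Let $\delta\ge 1$ be an integer and let $G$ be a finite simple connected graph of order $n\ge 8\delta+4$ with minimum degree $\delta(G)\ge\delta$. Let $k\ge 3$ be an odd integer and let $1\le d<k$ be an integer with $n\equiv d \pmod 2$. A $k$-matching of $G$ is a function $f:E(G)\to\{0,1,\dots,k\}$ with $\sum_{e\in E_G(v)}f(e)\le k$ for every vertex $v$, where $E_G(v)$ is the set of edges incident with $v$. The graph $G$ is called $k$-$d$-critical if for every $v\in V(G)$ there is a $k$-matching $f$ such that $\sum_{e\in E_G(v)}f(e)=k-d$ and $\sum_{e\in E_G(u)}f(e)=k$ for every $u\in V(G)\setminus\{v\}$. Let $\rho(\cdot)$ denote the largest eigenvalue of the adjacency matrix, $+$ the disjoint union of graphs, $\vee$ the join of graphs, and $\overline{K_\delta}$ the edgeless graph on $\delta$ vertices. If $$\rho(G)\ \ge\ \rho\bigl(K_\delta\vee(K_{n-2\delta}+\overline{K_\delta})\bigr),$$ then $G$ is $k$-$d$-critical unless $G\cong K_\delta\vee(K_{n-2\delta}+\overline{K_\delta})$, in which case $G$ is not $k$-$d$-critical. -/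

import Mathlib

namespace SimpleGraph

/-- The join `G ∨ H`: the disjoint union of `G` and `H` together with all edges between the two
vertex sets. -/
def graphJoin {V W : Type*} (G : SimpleGraph V) (H : SimpleGraph W) : SimpleGraph (V ⊕ W) :=
  (G ⊕g H) ⊔ completeBipartiteGraph V W

/-- The graph `K_δ ∨ (K_{n-2δ} + \overline{K_δ})`; it is of order `n` when `2 * δ ≤ n`. -/
def extremalGraph (n δ : ℕ) : SimpleGraph (Fin δ ⊕ (Fin (n - 2 * δ) ⊕ Fin δ)) :=
  graphJoin (completeGraph (Fin δ)) (completeGraph (Fin (n - 2 * δ)) ⊕g (completeGraph (Fin δ))ᶜ)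

open Classical in
/-- The adjacency spectral radius `ρ(G)`: the largest (real) eigenvalue of the adjacency matrix. -/
noncomputable def adjSpectralRadius {V : Type*} [Fintype V] (G : SimpleGraph V) : ℝ :=
  sSup {μ : ℝ | Module.End.HasEigenvalue (Matrix.toLin' (G.adjMatrix ℝ)) μ}

/-- On a nonempty vertex set the supremum defining `ρ(G)` is a maximum. -/
theorem isGreatest_adjSpectralRadius {V : Type*} [Fintype V] [DecidableEq V] [Nonempty V]
    (G : SimpleGraph V) [DecidableRel G.Adj] :
    IsGreatest {μ : ℝ | Module.End.HasEigenvalue (Matrix.toLin' (G.adjMatrix ℝ)) μ}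
      G.adjSpectralRadius := by
  have hA : (G.adjMatrix ℝ).IsHermitian := by
    rw [Matrix.IsHermitian, Matrix.conjTranspose_eq_transpose_of_trivial, transpose_adjMatrix]
  have hset : {μ : ℝ | Module.End.HasEigenvalue (Matrix.toLin' (G.adjMatrix ℝ)) μ}
      = Set.range hA.eigenvalues := by
    rw [← hA.spectrum_real_eq_range_eigenvalues]
    ext μ
    rw [Set.mem_ofPred_eq, Module.End.hasEigenvalue_iff_mem_spectrum, Matrix.spectrum_toLin']
  have hfin : {μ : ℝ | Module.End.HasEigenvalue (Matrix.toLin' (G.adjMatrix ℝ)) μ}.Finite := by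
    rw [hset]; exact Set.finite_range _
  have hne : {μ : ℝ | Module.End.HasEigenvalue (Matrix.toLin' (G.adjMatrix ℝ)) μ}.Nonempty := by
    rw [hset]; exact Set.range_nonempty _
  have hs : G.adjSpectralRadius
      = sSup {μ : ℝ | Module.End.HasEigenvalue (Matrix.toLin' (G.adjMatrix ℝ)) μ} := by
    unfold adjSpectralRadius
    congr!
  rw [hs]
  exact ⟨hne.csSup_mem hfin, fun _ hx => le_csSup hfin.bddAbove hx⟩

open Classical in
/-- The sum `∑_{e ∈ E_G(v)} f(e)` over the edges incident with `v`. -/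
noncomputable def edgeSumAt {V : Type*} [Fintype V] (G : SimpleGraph V) (f : G.edgeSet → ℕ)
    (v : V) : ℕ :=
  ∑ e ∈ Finset.univ.filter (fun e : G.edgeSet => v ∈ (e : Sym2 V)), f e

/-- `f : E(G) → {0, 1, …, k}` is a `k`-matching of `G`. -/
def IsKMatching {V : Type*} [Fintype V] (G : SimpleGraph V) (k : ℕ) (f : G.edgeSet → ℕ) : Prop :=
  (∀ e, f e ≤ k) ∧ ∀ v, G.edgeSumAt f v ≤ k

/-- `G` is `k`-`d`-critical: for every vertex `v` there is a `k`-matching whose sum at `v` is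
`k - d` and whose sum at every other vertex is `k`. The notion is only used for `1 ≤ d ≤ k` with
`k ≥ 3` odd and `|V(G)| ≡ d (mod 2)`. -/
def IsKDCritical {V : Type*} [Fintype V] (G : SimpleGraph V) (k d : ℕ) : Prop :=
  ∀ v : V, ∃ f : G.edgeSet → ℕ, G.IsKMatching k f ∧
    G.edgeSumAt f v = k - d ∧ ∀ u : V, u ≠ v → G.edgeSumAt f u = k

end SimpleGraph

/-! Suppose `G` is not critical. For some `v₀`, the blow-up replacing `v₀` by `k - d` and every
other vertex by `k` independent copies has no perfect matching, since such a matching projects to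
the required `k`-matching. The blow-up has even order, so Tutte's theorem gives a violating set `T`.
Let `S` be the set of vertices all of whose copies lie in `T`, and `s = |S|`. A component of `G - S`
gives at most `k` components of the blow-up minus `T` if it is a single vertex and at most one
otherwise, while `|T| ≥ k s - d`. Hence `s ≥ 1`, and `G - S` has at least `s + 1` components, or
exactly `s`, all singletons (`exists_partition_of_not_isKDCritical`).

Let `L - 1 = n - δ + η - 1` be the eigenvalue of the extremal graph given by `exists_excess`; it is
at most `ρ(G)`. Weight `S` by `1` and a component of size `m` by `s / (L - m)`. If `s ∑ m / (L - m)
≤ L - s`, then `A x ≤ (L - 1) x`, and `L - 1 ≤ ρ(G)` forces equality and the presence of every edge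
the partition allows (`join_of_le_adjSpectralRadius`). When there are at least `s + 1` components,
convexity makes the sum largest for `s` parts of the least size the minimum degree permits and one
big part (`sum_div_sub_le`). The inequality is then strict for `s ≠ δ` (`excess_ineq_of_lt`,
`excess_ineq_of_gt`), a contradiction; for `s = δ` it is an equality exactly at the extremal graph.

Conversely, the extremal graph has `δ` independent vertices with only `δ` neighbours in all, so none
of those neighbours can be the deficient vertex. -/

namespace SimpleGraph

/-! ### Comparison of positive vectors with the spectral radius -/

/-- An eigenvector for the adjacency spectral radius. -/
theorem exists_eigenvector_adjSpectralRadius {V : Type*} [Fintype V] [Nonempty V]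
    (G : SimpleGraph V) [DecidableRel G.Adj] :
    ∃ z : V → ℝ, z ≠ 0 ∧
      ∀ v, (∑ u, if G.Adj v u then z u else 0) = G.adjSpectralRadius * z v := by
  classical
  obtain ⟨z, hz⟩ := (isGreatest_adjSpectralRadius G).1.exists_hasEigenvector
  refine ⟨z, hz.2, fun v => ?_⟩
  have h := congrFun hz.apply_eq_smul v
  simpa [Matrix.mulVec, dotProduct, adjMatrix_apply] using h

theorem le_adjSpectralRadius_of_eigenvector {V : Type*} [Fintype V]
    (G : SimpleGraph V) [DecidableRel G.Adj] (x : V → ℝ) (hx : x ≠ 0) (μ : ℝ)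
    (h : ∀ v, (∑ u, if G.Adj v u then x u else 0) = μ * x v) :
    μ ≤ G.adjSpectralRadius := by
  classical
  obtain ⟨v, -⟩ := Function.ne_iff.1 hx
  have : Nonempty V := ⟨v⟩
  refine (isGreatest_adjSpectralRadius G).2
    (Module.End.hasEigenvalue_of_hasEigenvector (x := x) ⟨?_, hx⟩)
  rw [Module.End.mem_eigenspace_iff]
  ext v
  simpa [Matrix.mulVec, dotProduct, adjMatrix_apply] using h v

/-- A positive vector `x` with `A x ≤ l x` and `l ≤ ρ(G)` on a connected graph satisfies
`A x = l x`. -/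
theorem row_eq_of_le_adjSpectralRadius {V : Type*} [Fintype V]
    (G : SimpleGraph V) [DecidableRel G.Adj] (hconn : G.Connected) (x : V → ℝ)
    (hx : ∀ v, 0 < x v) (l : ℝ)
    (hle : ∀ v, (∑ u, if G.Adj v u then x u else 0) ≤ l * x v)
    (hl : l ≤ G.adjSpectralRadius) (v : V) :
    (∑ u, if G.Adj v u then x u else 0) = l * x v := by
  have := hconn.nonempty
  obtain ⟨z, hz0, hz⟩ := G.exists_eigenvector_adjSpectralRadius
  set μ := G.adjSpectralRadius
  -- The eigenvector may change sign, so `|z|` is compared with `x` at a vertex of largest ratio.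
  -- The inequalities are tight there, and tightness passes to the neighbours.
  obtain ⟨v₀, hv₀⟩ := Finite.exists_max (fun v => |z v| / x v)
  set t := |z v₀| / x v₀ with ht
  have hbound : ∀ u, |z u| ≤ t * x u := fun u => (div_le_iff₀ (hx u)).1 (hv₀ u)
  have htpos : 0 < t := by
    obtain ⟨u, hu⟩ := Function.ne_iff.1 hz0
    have h1 : 0 < |z u| := abs_pos.2 hu
    have h2 := hbound u
    by_contra hneg
    nlinarith [hx u]
  have key : ∀ w, |z w| = t * x w →
      (∑ u, if G.Adj w u then x u else 0) = l * x w ∧ ∀ u, G.Adj w u → |z u| = t * x u := by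
    intro w hw
    have h1 : μ * |z w| ≤ ∑ u, if G.Adj w u then |z u| else 0 := by
      calc μ * |z w| ≤ |μ * z w| := by
            rw [abs_mul]; gcongr; exact le_abs_self _
        _ = |∑ u, if G.Adj w u then z u else 0| := by rw [hz]
        _ ≤ ∑ u, |if G.Adj w u then z u else 0| := Finset.abs_sum_le_sum_abs _ _
        _ = _ := Finset.sum_congr rfl fun u _ => by split_ifs <;> simp
    have h2 : ∀ u ∈ Finset.univ, (if G.Adj w u then |z u| else 0)
        ≤ (if G.Adj w u then t * x u else 0) := by
      intro u _; split_ifs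
      · exact hbound u
      · exact le_rfl
    have h3 : (∑ u, if G.Adj w u then t * x u else 0)
        = t * ∑ u, if G.Adj w u then x u else 0 := by
      rw [Finset.mul_sum]; exact Finset.sum_congr rfl fun u _ => by split_ifs <;> simp
    have h4 := Finset.sum_le_sum h2
    have h5 : t * (l * x w) ≤ μ * |z w| := by
      rw [hw]; nlinarith [mul_le_mul_of_nonneg_right hl (mul_pos htpos (hx w)).le]
    have h6 := mul_le_mul_of_nonneg_left (hle w) htpos.le
    refine ⟨le_antisymm (hle w) ?_, fun u hu => ?_⟩
    · refine le_of_mul_le_mul_left ?_ htpos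
      linarith
    · have h7 := (Finset.sum_eq_sum_iff_of_le h2).1 (by linarith) u (Finset.mem_univ u)
      simpa [hu] using h7
  have hwalk : ∀ a b, G.Walk a b → |z a| = t * x a → |z b| = t * x b := by
    intro a b p
    induction p with
    | nil => exact id
    | cons hadj p ih => exact fun ha => ih ((key _ ha).2 _ hadj)
  have hall : ∀ w, |z w| = t * x w := fun w => by
    obtain ⟨p⟩ := hconn.preconnected v₀ w
    exact hwalk v₀ w p (by rw [ht, div_mul_cancel₀ _ (hx v₀).ne'])
  exact (key v (hall v)).1

/-! ### Weights constant on a separating set and on the parts -/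

/-- The number of vertices in the part `o` of a partition. -/
def partSize {V ι : Type*} [Fintype V] [DecidableEq ι] (c : V → Option ι) (o : Option ι) : ℕ :=
  (Finset.univ.filter fun v => c v = o).card

theorem sum_comp_eq_sum_partSize {V ι : Type*} [Fintype V] [Fintype ι] [DecidableEq ι]
    (c : V → Option ι) (F : Option ι → ℝ) :
    ∑ v, F (c v) = ∑ o, (partSize c o : ℝ) * F o := by
  rw [← Finset.sum_fiberwise Finset.univ c]
  refine Finset.sum_congr rfl fun o _ => ?_
  rw [Finset.sum_congr rfl (g := fun _ => F o) (fun v hv => by rw [(Finset.mem_filter.1 hv).2])]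
  simp [partSize]

theorem sum_partSize {V ι : Type*} [Fintype V] [Fintype ι] [DecidableEq ι] (c : V → Option ι) :
    (partSize c none : ℝ) + ∑ C, (partSize c (some C) : ℝ) = Fintype.card V := by
  have h := sum_comp_eq_sum_partSize c (fun _ => 1)
  simp [Fintype.sum_option] at h
  linarith

/-- Two vertices in parts `a` and `b` may be adjacent: one of them is in the separating part `none`,
or the parts agree. -/
def Compat {ι : Type*} (a b : Option ι) : Prop := a = none ∨ b = none ∨ a = b

/-- The weights are eigenvector-like for the graph with all compatible edges, with slack only in the
rows of the separating part. Large `ρ(G)` removes the slack, and a missing edge would make some row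
strict. -/
theorem join_of_le_adjSpectralRadius {V ι : Type*} [Fintype V] [Fintype ι] [DecidableEq ι]
    (G : SimpleGraph V) (hconn : G.Connected) (c : V → Option ι)
    (hc : ∀ u v, G.Adj u v → Compat (c u) (c v)) (L : ℝ) (hs : 0 < partSize c none)
    (hL : ∀ C, (partSize c (some C) : ℝ) < L)
    (hsum : (partSize c none : ℝ) * ∑ C, (partSize c (some C) : ℝ) / (L - partSize c (some C))
      ≤ L - partSize c none)
    (hρ : L - 1 ≤ G.adjSpectralRadius) :
    (partSize c none : ℝ) * ∑ C, (partSize c (some C) : ℝ) / (L - partSize c (some C))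
      = L - partSize c none ∧ ∀ u v, u ≠ v → Compat (c u) (c v) → G.Adj u v := by
  classical
  set s : ℝ := ((partSize c none : ℕ) : ℝ) with hsdef
  set m : ι → ℝ := fun C => ((partSize c (some C) : ℕ) : ℝ) with hm
  have hs0 : 0 < s := Nat.cast_pos.2 hs
  have hLm : ∀ C, 0 < L - m C := fun C => sub_pos.2 (hL C)
  -- The value `y = s / (L - m)` solves the row equation `s + (m - 1) y = (L - 1) y` of a clique of
  -- size `m` joined to the separating part.
  let w : Option ι → ℝ := fun o => o.elim 1 (fun C => s / (L - m C))
  have hw : ∀ o, 0 < w o := by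
    rintro (_ | C)
    · exact one_pos
    · exact div_pos hs0 (hLm C)
  let T : Option ι → ℝ := fun a => (∑ v, if Compat a (c v) then w (c v) else 0) - w a
  have hTsum : ∀ v, (∑ u, if u ≠ v ∧ Compat (c v) (c u) then w (c u) else 0) = T (c v) := by
    intro v
    have h1 : ∀ u, (if u ≠ v ∧ Compat (c v) (c u) then w (c u) else 0)
        = (if Compat (c v) (c u) then w (c u) else 0) - (if u = v then w (c v) else 0) := by
      intro u
      by_cases huv : u = v
      · subst huv; simp [Compat]
      · simp [huv]
    simp only [h1, T, Finset.sum_sub_distrib, Finset.sum_ite_eq',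
      Finset.mem_univ, if_true]
  have hTnone : T none = s + s * (∑ C, m C / (L - m C)) - 1 := by
    have := sum_comp_eq_sum_partSize c w
    simp only [T, Compat, true_or, if_true, this, Fintype.sum_option]
    simp only [w, Option.elim, mul_one, Finset.mul_sum, ← hsdef]
    congr 2
    exact Finset.sum_congr rfl fun C _ => by rw [mul_div_left_comm]
  have hTsome : ∀ C, T (some C) = (L - 1) * w (some C) := by
    intro C
    have := sum_comp_eq_sum_partSize c (fun o => if Compat (some C) o then w o else 0)
    simp only [T, this, Fintype.sum_option]
    simp [Compat, w]
    have := (hLm C).ne'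
    rw [← hsdef]
    change s + m C * (s / (L - m C)) - s / (L - m C) = _
    field_simp
    ring
  have hrow : ∀ v, (∑ u, if G.Adj v u then w (c u) else 0) ≤ T (c v) := by
    intro v
    rw [← hTsum]
    refine Finset.sum_le_sum fun u _ => ?_
    by_cases h : G.Adj v u
    · simp [h, h.ne', hc v u h]
    · rw [if_neg h]; split_ifs
      · exact (hw _).le
      · exact le_rfl
  have hT : ∀ o, T o ≤ (L - 1) * w o := by
    rintro (_ | C)
    · rw [hTnone]; simp only [w, Option.elim]; linarith
    · exact (hTsome C).le
  have heq := G.row_eq_of_le_adjSpectralRadius hconn (fun v => w (c v)) (fun v => hw _) (L - 1)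
    (fun v => (hrow v).trans (hT _)) hρ
  refine ⟨?_, ?_⟩
  · obtain ⟨v, hv⟩ := Finset.card_pos.1 hs
    have hv : c v = none := (Finset.mem_filter.1 hv).2
    have h2 := (heq v).symm.trans_le (hrow v)
    rw [hv, hTnone] at h2
    simp only [w, Option.elim] at h2
    linarith
  · intro v u hvu hcomp
    by_contra hadj
    have h1 := heq v
    have : (∑ u, if G.Adj v u then w (c u) else 0) < T (c v) := by
      rw [← hTsum]
      refine Finset.sum_lt_sum (fun u _ => ?_) ⟨u, Finset.mem_univ _, ?_⟩
      · by_cases h : G.Adj v u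
        · simp [h, h.ne', hc v u h]
        · rw [if_neg h]; split_ifs
          · exact (hw _).le
          · exact le_rfl
      · simp [hadj, hvu.symm, hcomp, hw]
    exact absurd h1 (this.trans_le (hT _)).ne


/-! ### Real inequalities -/

/-- Among at least `s + 1` reals `m i ≥ h` of sum `N`, the sum of the convex function `m / (L - m)`
is largest when `s` of them are `h` and one is `N - s h`. -/
theorem sum_div_sub_le {ι : Type*} [Fintype ι] (m : ι → ℝ) (h L s : ℝ) (hs : 0 ≤ s)
    (hh : 0 < h) (hm : ∀ i, h ≤ m i) (hcard : s + 1 ≤ Fintype.card ι)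
    (hL : (∑ i, m i) - s * h < L) :
    (∀ i, m i ≤ (∑ i, m i) - s * h) ∧
    (∑ i, m i / (L - m i)) ≤
      s * (h / (L - h)) + ((∑ i, m i) - s * h) / (L - ((∑ i, m i) - s * h)) ∧
    ((∑ i, m i / (L - m i)) =
      s * (h / (L - h)) + ((∑ i, m i) - s * h) / (L - ((∑ i, m i) - s * h)) →
      (Fintype.card ι : ℝ) = s + 1 ∧ ∀ i, m i = h ∨ m i = (∑ i, m i) - s * h) := by
  classical
  set N := ∑ i, m i with hN
  set M := N - s * h with hMdef
  have hle : ∀ i, m i ≤ M := by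
    intro i
    have h1 : N = m i + ∑ j ∈ Finset.univ.erase i, m j :=
      (Finset.add_sum_erase _ _ (Finset.mem_univ i)).symm
    have h2 : ((Finset.univ.erase i).card : ℝ) * h ≤ ∑ j ∈ Finset.univ.erase i, m j := by
      rw [← nsmul_eq_mul]; exact Finset.card_nsmul_le_sum _ _ _ fun j _ => hm j
    have h3 : ((Finset.univ.erase i).card : ℝ) = Fintype.card ι - 1 := by
      rw [Finset.card_erase_of_mem (Finset.mem_univ i), Finset.card_univ,
        Nat.cast_sub (Fintype.card_pos_iff.2 ⟨i⟩)]
      simp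
    rw [h3] at h2
    nlinarith
  have hcpos : 0 < Fintype.card ι := by
    have : (0 : ℝ) < Fintype.card ι := by linarith
    exact_mod_cast this
  obtain ⟨i₀⟩ := Fintype.card_pos_iff.1 hcpos
  have hhM : h ≤ M := (hm i₀).trans (hle i₀)
  have hLM : 0 < L - M := by linarith
  have hLh : 0 < L - h := by linarith
  have hLpos : 0 < L := by linarith
  -- `κ` is the slope of the chord of `m / (L - m)` between `h` and `M`.
  set κ := L / ((L - M) * (L - h)) with hκ
  have hκpos : 0 < κ := by positivity
  have hterm : ∀ i, h / (L - h) + κ * (m i - h) - m i / (L - m i)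
      = κ * ((m i - h) * (M - m i) / (L - m i)) := by
    intro i
    have : 0 < L - m i := by linarith [hle i]
    rw [hκ]; field_simp; ring
  have hnonneg : ∀ i, 0 ≤ κ * ((m i - h) * (M - m i) / (L - m i)) := by
    intro i
    have h1 : 0 < L - m i := by linarith [hle i]
    have h2 := sub_nonneg.2 (hle i)
    have h3 := sub_nonneg.2 (hm i)
    positivity
  have hMterm : M / (L - M) = h / (L - h) + κ * (M - h) := by
    rw [hκ]; field_simp; ring
  have hhterm : h / (L - h) - κ * h = - (κ * h * M / L) := by
    rw [hκ]; field_simp; ring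
  have hsum : ∑ i, κ * ((m i - h) * (M - m i) / (L - m i)) =
      (Fintype.card ι) * (h / (L - h)) + κ * (N - Fintype.card ι * h)
        - ∑ i, m i / (L - m i) := by
    rw [← Finset.sum_congr rfl fun i _ => hterm i]
    simp [Finset.sum_sub_distrib, Finset.sum_add_distrib, ← Finset.mul_sum, ← hN]
  -- The first term on the right is the loss from having more than `s + 1` parts (the chord has
  -- value `-κ h M / L` at `0`), the second the gap between chord and function. Both are
  -- nonnegative, so equality kills both.
  have hid : s * (h / (L - h)) + M / (L - M) - ∑ i, m i / (L - m i)
      = (Fintype.card ι - s - 1) * (κ * h * M / L)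
        + ∑ i, κ * ((m i - h) * (M - m i) / (L - m i)) := by
    have : κ * h * M / L = κ * h - h / (L - h) := by linarith
    rw [hsum, hMterm, this, hMdef]
    ring
  have hpos : 0 < κ * h * M / L := by
    have : 0 < M := by linarith
    positivity
  have hS := Finset.sum_nonneg fun i (_ : i ∈ Finset.univ) => hnonneg i
  have hc : 0 ≤ (Fintype.card ι - s - 1) * (κ * h * M / L) :=
    mul_nonneg (by linarith) hpos.le
  refine ⟨hle, by linarith, fun heq => ⟨?_, fun i => ?_⟩⟩
  · have : (Fintype.card ι - s - 1) * (κ * h * M / L) = 0 := by linarith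
    rcases mul_eq_zero.1 this with h0 | h0
    · linarith
    · exact absurd h0 hpos.ne'
  · have h0 : ∑ i, κ * ((m i - h) * (M - m i) / (L - m i)) = 0 := by linarith
    have h1 := (Finset.sum_eq_zero_iff_of_nonneg fun i _ => hnonneg i).1 h0 i (Finset.mem_univ i)
    have h2 : L - m i ≠ 0 := by linarith [hle i]
    have h3 : (m i - h) * (M - m i) = 0 := by
      simpa [hκpos.ne', h2] using h1
    rcases mul_eq_zero.1 h3 with h4 | h4
    · left; linarith
    · right; linarith

/-- The cubic relation satisfied by the excess `η` of `ρ + 1` over `n - δ` for the extremal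
graph. -/
theorem exists_excess (n δ : ℝ) (hδ : 1 ≤ δ) (hn : 8 * δ + 4 ≤ n) :
    ∃ η, 0 < η ∧ η < δ ∧ η * ((n - δ + η) * (n - δ + η - 1)) = δ ^ 2 * (η + δ) := by
  let p : ℝ → ℝ := fun η => η * ((n - δ + η) * (n - δ + η - 1)) - δ ^ 2 * (η + δ)
  have hp : ContinuousOn p (Set.Icc 0 δ) := by fun_prop
  have h0 : p 0 < 0 := by
    have : 0 < δ ^ 3 := by positivity
    simp only [p]; nlinarith
  have h1 : 0 < p δ := by
    simp only [p]
    have : 2 * δ ^ 2 < n * (n - 1) := by nlinarith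
    have h2 : δ * ((n - δ + δ) * (n - δ + δ - 1)) - δ ^ 2 * (δ + δ)
      = δ * (n * (n - 1) - 2 * δ ^ 2) := by ring
    rw [h2]
    exact mul_pos (by linarith) (by linarith)
  obtain ⟨η, hη, hη0⟩ := intermediate_value_Ioo (by linarith) hp ⟨h0, h1⟩
  exact ⟨η, hη.1, hη.2, by simp only [p] at hη0; linarith⟩

theorem adjSpectralRadius_extremalGraph_ge (n δ : ℕ) (hδ : 1 ≤ δ) (hn : 8 * δ + 4 ≤ n) (η : ℝ)
    (hη : 0 < η)
    (heq : η * (((n : ℝ) - δ + η) * (n - δ + η - 1)) = δ ^ 2 * (η + δ)) :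
    (n : ℝ) - δ + η - 1 ≤ (extremalGraph n δ).adjSpectralRadius := by
  classical
  have hδ' : (1 : ℝ) ≤ δ := by exact_mod_cast hδ
  have hn' : 8 * (δ : ℝ) + 4 ≤ n := by exact_mod_cast hn
  set L : ℝ := n - δ + η with hL
  have hq : ((n - 2 * δ : ℕ) : ℝ) = L - δ - η := by
    rw [Nat.cast_sub (by omega)]; push_cast; linarith
  -- These are the weights `s / (L - m)` with `s = δ` and `m = n - 2δ` or `m = 1`. The cubic for `η`
  -- is the row equation at the `δ` dominating vertices.
  refine le_adjSpectralRadius_of_eigenvector _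
    (Sum.elim (fun _ => 1) (Sum.elim (fun _ => δ / (η + δ)) (fun _ => δ / (L - 1)))) ?_ _ ?_
  · intro h
    have := congrFun h (Sum.inl ⟨0, hδ⟩)
    simp at this
  have hL1 : L - 1 ≠ 0 := by linarith
  have hηδ : η + δ ≠ 0 := by linarith
  have hfin : ∀ (N : ℕ) (a : Fin N) (t : ℝ),
      (∑ u : Fin N, if (a : ℕ) = u then 0 else t) = (N - 1) * t := by
    intro N a t
    have : ∀ u : Fin N, (if (a : ℕ) = u then (0 : ℝ) else t) = t - if a = u then t else 0 := by
      intro u; simp only [← Fin.ext_iff]; split_ifs <;> simp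
    simp [this]; ring
  rintro (a | a | a)
  · simp [extremalGraph, graphJoin, Fintype.sum_sum_type, hq, Fin.ext_iff, hfin]
    field_simp
    linear_combination -heq
  · have h3 := hfin (n - 2 * δ) a (δ / (η + δ))
    have h4 : (δ : ℝ) + (L - δ - η - 1) * (δ / (η + δ)) = (L - 1) * (δ / (η + δ)) := by
      field_simp; ring
    simp only [extremalGraph, graphJoin, Fintype.sum_sum_type, Sum.elim_inl, Sum.elim_inr]
    rw [← h4, ← hq, ← h3]
    simp [Fin.ext_iff]
  · simp [extremalGraph, graphJoin, Fintype.sum_sum_type]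
    field_simp

/-- The separating-set inequality for more than `δ` vertices. -/
theorem excess_ineq_of_gt (n δ s η : ℝ) (hδ : 1 ≤ δ) (hn : 8 * δ + 4 ≤ n) (hη : 0 < η)
    (hηδ : η < δ) (heq : η * ((n - δ + η) * (n - δ + η - 1)) = δ ^ 2 * (η + δ))
    (hs : δ < s) (hsn : 2 * s ≤ n) :
    s * (s * (1 / (n - δ + η - 1)) + (n - 2 * s) / (n - δ + η - (n - 2 * s)))
      < n - δ + η - s := by
  obtain ⟨D, hDdef⟩ : ∃ D, D = 2 * s - δ + η := ⟨_, rfl⟩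
  obtain ⟨L, hLdef⟩ : ∃ L, L = n - δ + η := ⟨_, rfl⟩
  have hD : 0 < D := by linarith
  have hL : 0 < L - 1 := by linarith
  rw [show n - 2 * s = L - D by linarith, ← hLdef, sub_sub_cancel, ← sub_pos]
  have key : L - s - s * (s * (1 / (L - 1)) + (L - D) / D)
      = (L * (L - 1) * (D - s) - s ^ 2 * D) / ((L - 1) * D) := by
    field_simp; ring
  rw [key, hDdef, hLdef]
  rw [hDdef] at hD
  rw [hLdef] at hL
  refine div_pos ?_ (mul_pos hL hD)
  -- By the cubic, the left side vanishes at `s = δ`; hence the factor `s - δ`.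
  have h1 : (n - δ + η) * (n - δ + η - 1) * (2 * s - δ + η - s) - s ^ 2 * (2 * s - δ + η)
      = (s - δ) * ((n - δ + η) * (n - δ + η - 1) - 2 * (s ^ 2 + s * δ + δ ^ 2)
        + (δ - η) * (s + δ)) := by
    linear_combination heq
  rw [h1]
  have h2 : (n - δ) * (n - δ - 1) ≤ (n - δ + η) * (n - δ + η - 1) := by nlinarith
  have h3 : 2 * (s ^ 2 + s * δ + δ ^ 2) ≤ n ^ 2 / 2 + n * δ + 2 * δ ^ 2 := by nlinarith
  have h4 : n ^ 2 / 2 + n * δ + 2 * δ ^ 2 < (n - δ) * (n - δ - 1) := by nlinarith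
  have h5 : 0 < (δ - η) * (s + δ) := mul_pos (by linarith) (by linarith)
  exact mul_pos (by linarith) (by linarith)

/-- The separating-set inequality for fewer than `δ` vertices. -/
theorem excess_ineq_of_lt (n δ s η : ℝ) (hδ : 2 ≤ δ) (hn : 8 * δ + 4 ≤ n) (hη : 0 < η)
    (heq : η * ((n - δ + η) * (n - δ + η - 1)) = δ ^ 2 * (η + δ))
    (hs : s = 1 ∨ 2 ≤ s) (hsδ : s + 1 ≤ δ) (hsn : s * (δ + 1 - s) ≤ n) :
    s * (s * ((δ + 1 - s) / (n - δ + η - (δ + 1 - s))) +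
      (n - s - s * (δ + 1 - s)) / (n - δ + η - (n - s - s * (δ + 1 - s))))
      < n - δ + η - s := by
  rcases hs with rfl | hs
  -- For `s = 1` the gap between `L` and the big part is `η + 1`, which can be close to `1`, too
  -- small for the crude estimate below; the cubic replaces it.
  · have hL : 0 < n - 2 * δ + η := by linarith
    have hη1 : 0 < η + 1 := by linarith
    rw [show n - δ + η - (δ + 1 - 1) = n - 2 * δ + η by ring,
      show n - δ + η - (n - 1 - 1 * (δ + 1 - 1)) = η + 1 by ring, ← sub_pos]
    have key : n - δ + η - 1 - 1 * (1 * ((δ + 1 - 1) / (n - 2 * δ + η)) +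
      (n - 1 - 1 * (δ + 1 - 1)) / (η + 1))
        = ((n - δ + η) * η * (n - 2 * δ + η) - δ * (η + 1))
        / ((n - 2 * δ + η) * (η + 1)) := by
      obtain ⟨y, hy⟩ : ∃ y, y = n - 2 * δ + η := ⟨_, rfl⟩
      rw [← hy] at hL ⊢
      obtain rfl : n = y + 2 * δ - η := by linarith
      field_simp; ring
    rw [key]
    refine div_pos ?_ (mul_pos hL hη1)
    have h1 : 0 < (n - δ + η) * η := mul_pos (by linarith) hη
    have h2 : (n - δ + η) * η * (n - δ + η - 1) ≤ (n - δ + η) * η * (2 * (n - 2 * δ + η)) :=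
      mul_le_mul_of_nonneg_left (by linarith) h1.le
    have h3 : 2 * δ * (η + 2) ≤ δ ^ 2 * (η + δ) := by
      have : 2 * δ ≤ δ ^ 2 := by nlinarith
      exact mul_le_mul this (by linarith) (by linarith) (by positivity)
    nlinarith
  · set p := δ - s with hp
    have hp1 : 1 ≤ p := by linarith
    have hD : 0 < n - δ + η - (n - s - s * (δ + 1 - s)) := by nlinarith
    have hLh : 0 < n - δ + η - (δ + 1 - s) := by linarith
    have hLpos : 0 < n - δ + η := by linarith
    set D := n - δ + η - (n - s - s * (δ + 1 - s)) with hDdef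
    have hM : (n - s - s * (δ + 1 - s)) / D = (n - δ + η) / D - 1 := by
      field_simp; linarith
    -- Here `s (δ + 1 - s) ≤ n`, and the denominator is at least `n - 2δ + 1 ≥ 3n/4`.
    have h1 : s * ((δ + 1 - s) / (n - δ + η - (δ + 1 - s))) ≤ 4 / 3 := by
      rw [← mul_div_assoc, div_le_iff₀ hLh]; linarith
    -- `D = η + s + p (s - 1) ≥ 3s/2`, because `p ≥ 1` and `s ≥ 2`.
    have h2 : s / D ≤ 2 / 3 := by
      rw [div_le_iff₀ hD, hDdef]; nlinarith [mul_nonneg (by linarith : 0 ≤ s - 2) (by linarith : 0 ≤ p - 1)]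
    rw [hM]
    have h3 : s * ((n - δ + η) / D) ≤ (n - δ + η) * (2 / 3) := by
      rw [mul_div_left_comm]; exact mul_le_mul_of_nonneg_left h2 hLpos.le
    have h4 := mul_le_mul_of_nonneg_left h1 (by linarith : 0 ≤ s)
    nlinarith


/-! ### Blow-ups and Tutte's theorem -/

/-- A perfect matching of the blow-up of `G`, in which `v` becomes `w v` independent vertices,
yields edge weights on `G` of sum `w v` at every vertex `v`. -/
theorem exists_edgeSumAt_of_isPerfectMatching {V : Type*} [Fintype V] (G : SimpleGraph V)
    (w : V → ℕ) (M : (G.comap (Sigma.fst : (Σ v, Fin (w v)) → V)).Subgraph)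
    (hM : M.IsPerfectMatching) : ∃ f : G.edgeSet → ℕ, ∀ v, G.edgeSumAt f v = w v := by
  classical
  let φ : G.comap (Sigma.fst : (Σ v, Fin (w v)) → V) →g G := ⟨Sigma.fst, fun h => h⟩
  let π : M.edgeSet → G.edgeSet := fun e => φ.mapEdgeSet ⟨e.1, M.edgeSet_subset e.2⟩
  refine ⟨fun e => (Finset.univ.filter fun e' => π e' = e).card, fun v => ?_⟩
  have h1 : G.edgeSumAt (fun e => (Finset.univ.filter fun e' => π e' = e).card) v
      = (Finset.univ.filter fun e' => v ∈ (π e' : Sym2 V)).card := by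
    rw [Finset.card_eq_sum_card_fiberwise (f := π)
      (t := Finset.univ.filter fun e : G.edgeSet => v ∈ (e : Sym2 V))
      (fun e' he' => by simpa using he')]
    unfold edgeSumAt
    refine Finset.sum_congr (by congr!) fun e he => ?_
    refine congrArg Finset.card (Finset.ext fun e' => ?_)
    simp only [Finset.mem_filter, Finset.mem_univ, true_and] at he ⊢
    constructor
    · rintro rfl; exact ⟨he, rfl⟩
    · exact fun h => h.2
  have hπ : ∀ e' : M.edgeSet, v ∈ (π e' : Sym2 V) ↔ ∃ x : Σ v, Fin (w v),
      x ∈ (e' : Sym2 (Σ v, Fin (w v))) ∧ x.1 = v :=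
    fun e' => Sym2.mem_map
  simp only [h1, hπ]
  choose τ hτ using fun x => (Subgraph.isPerfectMatching_iff.1 hM x).exists
  have huniq : ∀ x y, M.Adj x y → y = τ x := fun x y h =>
    (Subgraph.isPerfectMatching_iff.1 hM x).unique h (hτ x)
  symm
  rw [← Fintype.card_fin (w v), ← Finset.card_univ]
  refine Finset.card_bij (fun j _ => ⟨s(⟨v, j⟩, τ ⟨v, j⟩), hτ ⟨v, j⟩⟩) ?_ ?_ ?_
  · intro j _
    simp only [Finset.mem_filter, Finset.mem_univ, true_and]
    exact ⟨⟨v, j⟩, Sym2.mem_mk_left _ _, rfl⟩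
  · intro j _ j' _ h
    have h2 : s((⟨v, j⟩ : Σ v, Fin (w v)), τ ⟨v, j⟩) = s(⟨v, j'⟩, τ ⟨v, j'⟩) :=
      congrArg Subtype.val h
    rcases Sym2.eq_iff.1 h2 with ⟨h3, -⟩ | ⟨h3, -⟩
    · simpa using h3
    · have h4 : G.Adj v (τ ⟨v, j'⟩).1 := M.adj_sub (hτ ⟨v, j'⟩)
      rw [← h3] at h4
      exact absurd rfl h4.ne
  · rintro ⟨e, he⟩ hv
    induction e using Sym2.ind with
    | _ x y =>
      have hxy : M.Adj x y := he
      obtain ⟨z, hz, rfl⟩ := (Finset.mem_filter.1 hv).2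
      rcases Sym2.mem_iff.1 hz with rfl | rfl
      · refine ⟨z.2, Finset.mem_univ _, Subtype.ext ?_⟩
        simp only [Sigma.eta]
        rw [huniq _ _ hxy]
      · refine ⟨z.2, Finset.mem_univ _, Subtype.ext ?_⟩
        simp only [Sigma.eta]
        rw [huniq _ _ hxy.symm, Sym2.eq_swap]

theorem isKDCritical_of_isPerfectMatching {V : Type*} [Fintype V] [DecidableEq V]
    (G : SimpleGraph V) (k d : ℕ)
    (h : ∀ v₀ : V, ∃ M : (G.comap (Sigma.fst :
      (Σ v, Fin (if v = v₀ then k - d else k)) → V)).Subgraph, M.IsPerfectMatching) :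
    G.IsKDCritical k d := by
  intro v₀
  obtain ⟨M, hM⟩ := h v₀
  obtain ⟨f, hf⟩ := G.exists_edgeSumAt_of_isPerfectMatching _ M hM
  have hle : ∀ v, G.edgeSumAt f v ≤ k := fun v => by
    rw [hf]; split_ifs
    · exact Nat.sub_le _ _
    · exact le_rfl
  refine ⟨f, ⟨fun e => ?_, hle⟩, by simp [hf], fun u hu => by simp [hf, hu]⟩
  obtain ⟨e, he⟩ := e
  induction e using Sym2.ind with
  | _ x y =>
    refine le_trans ?_ (hle x)
    unfold edgeSumAt
    exact Finset.single_le_sum (f := f) (fun _ _ => Nat.zero_le _) (by simp)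

/-- The partition of the vertices into a set `S` and the components of `G - S`. -/
noncomputable def sepPart {V : Type*} (G : SimpleGraph V) (S : Set V) (v : V) :
    Option (G.induce Sᶜ).ConnectedComponent :=
  open Classical in
  if h : v ∈ S then none else some ((G.induce Sᶜ).connectedComponentMk ⟨v, h⟩)

theorem sepPart_eq_none {V : Type*} {G : SimpleGraph V} {S : Set V} {v : V} :
    G.sepPart S v = none ↔ v ∈ S := by
  unfold sepPart; split_ifs with h <;> simp [h]

theorem sepPart_of_notMem {V : Type*} {G : SimpleGraph V} {S : Set V} {v : V} (h : v ∉ S) :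
    G.sepPart S v = some ((G.induce Sᶜ).connectedComponentMk ⟨v, h⟩) := by
  unfold sepPart; rw [dif_neg h]

theorem compat_sepPart {V : Type*} {G : SimpleGraph V} {S : Set V} {u v : V} (h : G.Adj u v) :
    Compat (G.sepPart S u) (G.sepPart S v) := by
  by_cases hu : u ∈ S
  · exact Or.inl (sepPart_eq_none.2 hu)
  by_cases hv : v ∈ S
  · exact Or.inr (Or.inl (sepPart_eq_none.2 hv))
  · refine Or.inr (Or.inr ?_)
    rw [sepPart_of_notMem hu, sepPart_of_notMem hv, Option.some_inj,
      ConnectedComponent.eq]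
    exact Adj.reachable (by simpa using h)

theorem sepPart_surj {V : Type*} {G : SimpleGraph V} {S : Set V}
    (C : (G.induce Sᶜ).ConnectedComponent) : ∃ v, G.sepPart S v = some C := by
  induction C using ConnectedComponent.ind with
  | _ v => exact ⟨v.1, sepPart_of_notMem v.2⟩

/-- In a blow-up of `G` with a vertex set `T` deleted, copies of vertices joined by a nontrivial
walk avoiding the fully deleted classes are connected. -/
theorem reachable_blowup {V : Type*} (G : SimpleGraph V) (w : V → ℕ)
    (T : Set (Σ v, Fin (w v))) {u u' : ({v | ∀ j, (⟨v, j⟩ : Σ v, Fin (w v)) ∈ T}ᶜ : Set V)}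
    (h : Relation.TransGen (G.induce {v | ∀ j, (⟨v, j⟩ : Σ v, Fin (w v)) ∈ T}ᶜ).Adj u u')
    (x y : ((⊤ : (G.comap (Sigma.fst : (Σ v, Fin (w v)) → V)).Subgraph).deleteVerts T).verts)
    (hx : x.1.1 = u) (hy : y.1.1 = u') :
    ((⊤ : (G.comap (Sigma.fst : (Σ v, Fin (w v)) → V)).Subgraph).deleteVerts T).coe.Reachable
      x y := by
  have hadj : ∀ x y : ((⊤ : (G.comap (Sigma.fst : (Σ v, Fin (w v)) → V)).Subgraph).deleteVerts
      T).verts, G.Adj x.1.1 y.1.1 →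
      ((⊤ : (G.comap (Sigma.fst : (Σ v, Fin (w v)) → V)).Subgraph).deleteVerts T).coe.Adj x y := by
    intro x y hxy
    rw [Subgraph.coe_adj, Subgraph.deleteVerts_adj]
    exact ⟨x.2.1, x.2.2, y.2.1, y.2.2, hxy⟩
  induction h generalizing y with
  | single h =>
    exact Adj.reachable (hadj x y (by rw [hx, hy]; exact h))
  | @tail b c hb hbc ih =>
    obtain ⟨j, hj⟩ : ∃ j, (⟨b.1, j⟩ : Σ v, Fin (w v)) ∉ T := by
      by_contra! h
      exact b.2 h
    have hz := ih ⟨⟨b.1, j⟩, ⟨trivial, hj⟩⟩ rfl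
    exact hz.trans (Adj.reachable (hadj _ _ (by rw [hy]; exact hbc)))

open Classical in
/-- The number of components of the blow-up minus `T`. -/
theorem card_component_blowup_le {V : Type*} [Fintype V] (G : SimpleGraph V) (w : V → ℕ) (k : ℕ)
    (hw : ∀ v, w v ≤ k) (T : Set (Σ v, Fin (w v))) (S : Set V)
    (hS : S = {v | ∀ j, (⟨v, j⟩ : Σ v, Fin (w v)) ∈ T}) :
    Nat.card ((⊤ : (G.comap (Sigma.fst : (Σ v, Fin (w v)) → V)).Subgraph).deleteVerts
      T).coe.ConnectedComponent ≤
      ∑ C, if partSize (G.sepPart S) (some C) = 1 then k else 1 := by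
  subst hS
  set S := {v | ∀ j, (⟨v, j⟩ : Σ v, Fin (w v)) ∈ T}
  set D := ((⊤ : (G.comap (Sigma.fst : (Σ v, Fin (w v)) → V)).Subgraph).deleteVerts T).coe
  have hmem : ∀ x : ((⊤ : (G.comap (Sigma.fst : (Σ v, Fin (w v)) → V)).Subgraph).deleteVerts
      T).verts, x.1.1 ∈ Sᶜ := fun x hx => x.2.2 (hx x.1.2)
  choose r hr using fun K : D.ConnectedComponent => K.exists_rep
  let comp : D.ConnectedComponent → (G.induce Sᶜ).ConnectedComponent :=
    fun K => (G.induce Sᶜ).connectedComponentMk ⟨(r K).1.1, hmem _⟩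
  -- The copy index is recorded only over singleton components of `G - S`, the only place where
  -- distinct copies can be disconnected.
  let g : D.ConnectedComponent → Σ _ : (G.induce Sᶜ).ConnectedComponent, ℕ := fun K =>
    ⟨comp K, if partSize (G.sepPart S) (some (comp K)) = 1 then ((r K).1.2 : ℕ) else 0⟩
  rw [Nat.card_eq_fintype_card, ← Finset.card_univ]
  have hcard : (Finset.univ.sigma fun C : (G.induce Sᶜ).ConnectedComponent =>
      Finset.range (if partSize (G.sepPart S) (some C) = 1 then k else 1)).card
      = ∑ C, if partSize (G.sepPart S) (some C) = 1 then k else 1 := by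
    rw [Finset.card_sigma]; simp
  refine le_trans ?_ (le_of_eq (hcard.trans (by congr!)))
  refine Finset.card_le_card_of_injOn g ?_ ?_
  · intro K _
    simp only [Finset.coe_sigma, Finset.mem_coe, Set.mem_sigma_iff, Finset.mem_univ, true_and, g,
      Finset.mem_range]
    split_ifs
    · exact (r K).1.2.2.trans_le (hw _)
    · exact one_pos
  · intro K _ K' _ hKK
    have hcomp : comp K = comp K' := congrArg Sigma.fst hKK
    have hidx : (if partSize (G.sepPart S) (some (comp K)) = 1 then ((r K).1.2 : ℕ) else 0) =
        if partSize (G.sepPart S) (some (comp K')) = 1 then ((r K').1.2 : ℕ) else 0 := by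
      have := hKK
      simp only [g, Sigma.mk.injEq] at this
      exact eq_of_heq this.2
    rw [← hcomp] at hidx
    have hreach : (G.induce Sᶜ).Reachable ⟨(r K).1.1, hmem _⟩ ⟨(r K').1.1, hmem _⟩ :=
      ConnectedComponent.eq.1 hcomp
    have hpart : ∀ v : ↥(Sᶜ : Set V), (G.induce Sᶜ).Reachable ⟨(r K).1.1, hmem _⟩ v ↔
        G.sepPart S v = some (comp K) := by
      intro v
      rw [sepPart_of_notMem v.2, Option.some_inj, ConnectedComponent.eq]
      exact ⟨fun h => h.symm, fun h => h.symm⟩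
    have htrans : ∀ a b : ↥(Sᶜ : Set V), a ≠ b → (G.induce Sᶜ).Reachable a b →
        Relation.TransGen (G.induce Sᶜ).Adj a b := by
      intro a b hab h
      rw [reachable_iff_reflTransGen, Relation.reflTransGen_iff_eq_or_transGen] at h
      rcases h with h | h
      · exact absurd h.symm hab
      · exact h
    have hfinal : D.Reachable (r K) (r K') := by
      by_cases huu : (⟨(r K).1.1, hmem _⟩ : ↥(Sᶜ : Set V)) = ⟨(r K').1.1, hmem _⟩
      · have huu' : (r K).1.1 = (r K').1.1 := congrArg Subtype.val huu
        by_cases h1 : partSize (G.sepPart S) (some (comp K)) = 1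
        · rw [if_pos h1, if_pos h1] at hidx
          have : r K = r K' := by
            apply Subtype.ext
            apply Sigma.ext huu'
            rw [Fin.heq_ext_iff (by rw [huu'])]
            exact hidx
          rw [this]
        -- Two copies of one vertex are not adjacent; a closed walk through another vertex of the
        -- component connects them.
        · have h2 : ∃ v, G.sepPart S v = some (comp K) ∧ v ≠ (r K).1.1 := by
            by_contra hcon
            push Not at hcon
            refine h1 (Finset.card_eq_one.2 ⟨(r K).1.1, ?_⟩)
            ext v
            simp only [Finset.mem_filter, Finset.mem_univ, true_and, Finset.mem_singleton]
            refine ⟨hcon v, ?_⟩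
            rintro rfl
            exact sepPart_of_notMem _
          obtain ⟨v, hv, hne⟩ := h2
          have hvS : v ∈ Sᶜ := fun h => by rw [sepPart_eq_none.2 h] at hv; simp at hv
          have h3 := (hpart ⟨v, hvS⟩).2 hv
          have hne' : (⟨(r K).1.1, hmem _⟩ : ↥(Sᶜ : Set V)) ≠ ⟨v, hvS⟩ :=
            fun h => hne (congrArg Subtype.val h).symm
          exact reachable_blowup G w T ((htrans _ _ hne' h3).trans (htrans _ _ hne'.symm h3.symm))
            _ _ rfl huu'.symm
      · exact reachable_blowup G w T (htrans _ _ huu hreach) _ _ rfl rfl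
    rw [← hr K, ← hr K']
    exact ConnectedComponent.eq.2 hfinal


/-- Compares `k s - d ≤ |T|` with the number of components of the blow-up minus `T`. The parity of
`n` and `d` is needed for Tutte's theorem and to exclude an empty separating set. -/
theorem exists_partition_of_not_isKDCritical.{u} {V : Type u} [Fintype V] (G : SimpleGraph V)
    (hconn : G.Connected) (hn : 2 ≤ Fintype.card V) (k d : ℕ) (hkodd : Odd k) (hd : 1 ≤ d)
    (hdk : d < k) (hnd : Fintype.card V ≡ d [MOD 2]) (hcrit : ¬ G.IsKDCritical k d) :
    ∃ (ι : Type u) (_ : Fintype ι) (_ : DecidableEq ι) (c : V → Option ι),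
      (∀ u v, G.Adj u v → Compat (c u) (c v)) ∧ (∀ C, 1 ≤ partSize c (some C)) ∧
      1 ≤ partSize c none ∧ (partSize c none + 1 ≤ Fintype.card ι ∨
        Fintype.card ι = partSize c none ∧ ∀ C, partSize c (some C) = 1) := by
  classical
  have hex : ∃ v₀ : V, ∀ M : (G.comap (Sigma.fst :
      (Σ v, Fin (if v = v₀ then k - d else k)) → V)).Subgraph, ¬ M.IsPerfectMatching := by
    by_contra! h
    exact hcrit (G.isKDCritical_of_isPerfectMatching k d h)
  obtain ⟨v₀, hM⟩ := hex
  set w : V → ℕ := fun v => if v = v₀ then k - d else k with hwdef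
  have hwk : ∀ v, w v ≤ k := fun v => by
    simp only [hwdef]; split_ifs
    · exact Nat.sub_le _ _
    · exact le_rfl
  have hwd : ∀ A : Finset V, k * A.card ≤ (∑ v ∈ A, w v) + d := by
    intro A
    have h1 : ∀ v ∈ A, k ≤ w v + if v = v₀ then d else 0 := fun v _ => by
      simp only [hwdef]; split_ifs <;> omega
    have h2 := Finset.card_nsmul_le_sum A _ k h1
    rw [Finset.sum_add_distrib, Finset.sum_ite_eq' A v₀] at h2
    rw [smul_eq_mul, mul_comm] at h2
    refine h2.trans (Nat.add_le_add_left ?_ _)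
    split_ifs <;> simp
  have hcardW : Fintype.card (Σ v, Fin (w v)) + d = k * Fintype.card V := by
    have h1 : ∀ v, k = w v + if v = v₀ then d else 0 := fun v => by
      simp only [hwdef]; split_ifs <;> omega
    have h2 : ∑ _v : V, k = ∑ v, (w v + if v = v₀ then d else 0) :=
      Finset.sum_congr rfl fun v _ => h1 v
    rw [Finset.sum_add_distrib, Finset.sum_ite_eq' Finset.univ v₀] at h2
    simp only [Finset.mem_univ, if_true, Finset.sum_const, Finset.card_univ, smul_eq_mul] at h2
    rw [Fintype.card_sigma]
    simp only [Fintype.card_fin]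
    rw [← h2, mul_comm]
  have heven : Even (Nat.card (Σ v, Fin (w v))) := by
    rw [Nat.card_eq_fintype_card]
    have h1 : Even (Fintype.card (Σ v, Fin (w v)) + d) ↔ Even d := by
      rw [hcardW, Nat.even_mul]
      have : ¬ Even k := Nat.not_even_iff_odd.2 hkodd
      have h3 : Even (Fintype.card V) ↔ Even d := by
        rw [Nat.even_iff, Nat.even_iff, hnd]
      tauto
    rw [Nat.even_add] at h1
    tauto
  obtain ⟨T, hT⟩ := exists_isTutteViolator hM heven
  set S : Set V := {v | ∀ j, (⟨v, j⟩ : Σ v, Fin (w v)) ∈ T} with hS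
  have hodd : T.ncard < Nat.card ((⊤ : (G.comap (Sigma.fst :
      (Σ v, Fin (w v)) → V)).Subgraph).deleteVerts T).coe.ConnectedComponent :=
    lt_of_lt_of_le hT (Set.ncard_le_card _)
  have hcount := hodd.trans_le (G.card_component_blowup_le w k hwk T S hS)
  set c := G.sepPart S with hc
  have hsize : ∀ C, 1 ≤ partSize c (some C) := fun C => by
    obtain ⟨v, hv⟩ := sepPart_surj C
    exact Finset.card_pos.2 ⟨v, by simpa using hv⟩
  have hTcard : k * partSize c none ≤ T.ncard + d := by
    refine (hwd _).trans (Nat.add_le_add_right ?_ d)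
    have h1 : ((Finset.univ.filter fun v => c v = none).sigma
        fun v => (Finset.univ : Finset (Fin (w v)))).card ≤ T.ncard := by
      rw [← Set.ncard_coe_finset]
      refine Set.ncard_le_ncard ?_ T.toFinite
      rintro ⟨v, j⟩ hvj
      simp only [Finset.coe_sigma, Set.mem_sigma_iff, Finset.mem_coe, Finset.mem_filter,
        Finset.mem_univ, true_and, and_true, hc, sepPart_eq_none] at hvj
      exact hvj j
    rw [Finset.card_sigma] at h1
    simpa using h1
  have hcount2 : T.ncard < k * (Finset.univ.filter fun C => partSize c (some C) = 1).card
      + (Finset.univ.filter fun C => ¬ partSize c (some C) = 1).card := by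
    rw [Finset.sum_ite] at hcount
    simp only [Finset.sum_const, smul_eq_mul, mul_one] at hcount
    rw [mul_comm]
    exact hcount.trans_le (le_of_eq (by congr!))
  have hsplit := Finset.card_filter_add_card_filter_not
    (s := (Finset.univ : Finset (G.induce Sᶜ).ConnectedComponent))
    (fun C => partSize c (some C) = 1)
  rw [Finset.card_univ] at hsplit
  refine ⟨_, inferInstance, inferInstance, c, fun u v h => compat_sepPart h, hsize, ?_, ?_⟩
  -- If `S` is empty, `G - S` is one component that is not a singleton. So `T` is empty and the
  -- blow-up has exactly one odd component, contrary to its even order.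
  · by_contra hs0
    have hSe : ∀ v, v ∉ S := by
      intro v hv
      refine hs0 (Finset.card_pos.2 ⟨v, ?_⟩)
      simpa using sepPart_eq_none.2 hv
    have hsub : ∀ C C' : (G.induce Sᶜ).ConnectedComponent, C = C' := by
      intro C C'
      induction C using ConnectedComponent.ind with
      | _ a =>
      induction C' using ConnectedComponent.ind with
      | _ b =>
      let φ : G →g G.induce Sᶜ := ⟨fun v => ⟨v, hSe v⟩, fun h => h⟩
      exact ConnectedComponent.eq.2 ((hconn.preconnected a b).map φ)
    have hbig : ∀ C, partSize c (some C) ≠ 1 := by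
      intro C hC
      have : partSize c (some C) = Fintype.card V := by
        rw [partSize, Finset.filter_true_of_mem, Finset.card_univ]
        intro v _
        rw [hc, sepPart_of_notMem (hSe v), hsub (connectedComponentMk _ _) C]
      omega
    have hle1 : Fintype.card (G.induce Sᶜ).ConnectedComponent ≤ 1 :=
      Fintype.card_le_one_iff.2 hsub
    have h0 : (Finset.univ.filter fun C => partSize c (some C) = 1).card = 0 := by
      rw [Finset.card_eq_zero, Finset.filter_eq_empty_iff]
      exact fun C _ => hbig C
    have hT0 : T.ncard = 0 := by
      rw [h0] at hcount2 hsplit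
      omega
    have hT1 : ((⊤ : (G.comap (Sigma.fst :
        (Σ v, Fin (w v)) → V)).Subgraph).deleteVerts T).coe.oddComponents.ncard = 1 := by
      have h1 : ((⊤ : (G.comap (Sigma.fst :
        (Σ v, Fin (w v)) → V)).Subgraph).deleteVerts T).coe.oddComponents.ncard ≤ _ :=
        Set.ncard_le_card _
      have h2 := G.card_component_blowup_le w k hwk T S hS
      have h3 : T.ncard < ((⊤ : (G.comap (Sigma.fst :
        (Σ v, Fin (w v)) → V)).Subgraph).deleteVerts T).coe.oddComponents.ncard := hT
      have h4 : (∑ C, if partSize (G.sepPart S) (some C) = 1 then k else 1) ≤ 1 := by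
        rw [Finset.sum_congr rfl fun C _ => if_neg (hbig C)]
        simpa using hle1
      have h5 := h1.trans (h2.trans (le_trans (le_of_eq (by congr!)) h4))
      omega
    have h6 := (odd_ncard_oddComponents ((⊤ : (G.comap (Sigma.fst :
        (Σ v, Fin (w v)) → V)).Subgraph).deleteVerts T).coe).1 (by rw [hT1]; exact odd_one)
    rw [(Set.ncard_eq_zero T.toFinite).1 hT0] at h6
    have h7 : Nat.card ((⊤ : (G.comap (Sigma.fst :
        (Σ v, Fin (w v)) → V)).Subgraph).deleteVerts ∅).verts = Nat.card (Σ v, Fin (w v)) := by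
      rw [Subgraph.deleteVerts_empty]
      exact Nat.card_congr (Equiv.Set.univ _)
    rw [h7] at h6
    exact Nat.not_even_iff_odd.2 h6 heven
  · set s := partSize c none
    set a := (Finset.univ.filter fun C => partSize c (some C) = 1).card with ha
    set q := (Finset.univ.filter fun C => ¬ partSize c (some C) = 1).card with hq
    rcases le_or_gt s a with hsa | hsa
    · rcases Nat.eq_zero_or_pos q with hq0 | hq0
      · rcases hsa.eq_or_lt with h | h
        · right
          refine ⟨by omega, fun C => ?_⟩
          have := (Finset.filter_eq_empty_iff.1 (Finset.card_eq_zero.1 hq0)) (Finset.mem_univ C)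
          simpa using this
        · left; omega
      · left; omega
    -- Here `k (s - a) < q + d` with `d < k`, so `q` exceeds `s - a`.
    · left
      obtain ⟨t, ht⟩ : ∃ t, s = a + 1 + t := ⟨s - (a + 1), by omega⟩
      rw [ht] at hTcard ⊢
      have h1 : k * (a + 1 + t) = k * a + k + k * t := by ring
      have h2 : 1 * t ≤ k * t := Nat.mul_le_mul_right t (by omega)
      omega

/-! ### The extremal graph: failure of criticality and recognition -/

/-- Every edge at the independent set `I` ends in the dominating set `J`, also of size `δ`. So the
total over `I` is at most that over `J`, which fails when the deficient vertex lies in `J`. -/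
theorem not_isKDCritical_of_iso_extremalGraph {V : Type*} [Fintype V] (G : SimpleGraph V)
    (n δ k d : ℕ) (hδ : 0 < δ) (hd : 1 ≤ d) (hdk : d < k) (e : G ≃g extremalGraph n δ) :
    ¬ G.IsKDCritical k d := by
  classical
  intro hcrit
  obtain ⟨f, -, h0, h1⟩ := hcrit (e.symm (Sum.inl ⟨0, hδ⟩))
  let I : Fin δ → V := fun a => e.symm (Sum.inr (Sum.inr a))
  let J : Fin δ → V := fun a => e.symm (Sum.inl a)
  have hswap : ∀ K : Fin δ → V, ∑ a, G.edgeSumAt f (K a)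
      = ∑ x : G.edgeSet, (Finset.univ.filter fun a => K a ∈ (x : Sym2 V)).card * f x := by
    intro K
    have : ∀ v, G.edgeSumAt f v = ∑ x : G.edgeSet, if v ∈ (x : Sym2 V) then f x else 0 := by
      intro v
      rw [← Finset.sum_filter]
      unfold edgeSumAt
      exact Finset.sum_congr (by congr!) fun _ _ => rfl
    simp only [this]
    rw [Finset.sum_comm]
    refine Finset.sum_congr rfl fun x _ => ?_
    rw [← Finset.sum_filter]
    simp
  have hmain : ∑ a, G.edgeSumAt f (I a) ≤ ∑ a, G.edgeSumAt f (J a) := by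
    rw [hswap, hswap]
    refine Finset.sum_le_sum fun x _ => Nat.mul_le_mul_right _ ?_
    rcases (Finset.univ.filter fun a => I a ∈ (x : Sym2 V)).eq_empty_or_nonempty with h | ⟨a, ha⟩
    · rw [h]; simp
    · have ha : I a ∈ (x : Sym2 V) := (Finset.mem_filter.1 ha).2
      obtain ⟨y, hy⟩ := ha
      have hadj : G.Adj (I a) y := by
        have := x.2; rw [hy] at this; exact this
      have hadj' : (extremalGraph n δ).Adj (Sum.inr (Sum.inr a)) (e y) := by
        have := e.map_rel_iff.2 hadj
        simpa [I] using this
      obtain ⟨b, hb⟩ : ∃ b, y = J b := by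
        rcases hey : e y with b | b | b
        · exact ⟨b, by simp [J, ← hey]⟩
        · rw [hey] at hadj'; simp [extremalGraph, graphJoin] at hadj'
        · rw [hey] at hadj'; simp [extremalGraph, graphJoin] at hadj'
      subst hb
      have h2 : (Finset.univ.filter fun a => I a ∈ (x : Sym2 V)).card ≤ 1 := by
        rw [Finset.card_le_one]
        have : ∀ a', I a' ∈ (x : Sym2 V) → a' = a := by
          intro a' h
          rw [hy, Sym2.mem_iff] at h
          rcases h with h | h
          · simpa [I] using h
          · simp [I, J] at h
        intro a₁ h₁ a₂ h₂
        rw [this a₁ (Finset.mem_filter.1 h₁).2, this a₂ (Finset.mem_filter.1 h₂).2]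
      exact h2.trans (Finset.card_pos.2 ⟨b, by simp [hy]⟩)
  have hI : ∑ a, G.edgeSumAt f (I a) = ∑ _a : Fin δ, k :=
    Finset.sum_congr rfl fun a _ => h1 _ (by simp [I])
  have hJ : ∑ a, G.edgeSumAt f (J a) < ∑ _a : Fin δ, k := by
    refine Finset.sum_lt_sum (fun a _ => ?_) ⟨⟨0, hδ⟩, Finset.mem_univ _, ?_⟩
    · by_cases ha : a = ⟨0, hδ⟩
      · subst ha; exact h0.trans_le (Nat.sub_le _ _)
      · exact (h1 _ (by simpa [J] using ha)).le
    · exact h0.trans_lt (by omega)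
  omega

/-- Graphs whose adjacency is the same relation between vertex colours, with colour classes of
equal sizes, are isomorphic. -/
theorem nonempty_iso_of_coloring {V W A : Type*} [Fintype V] [Fintype W] [DecidableEq A]
    (G : SimpleGraph V) (H : SimpleGraph W) (R : A → A → Prop) (f : V → A) (g : W → A)
    (hG : ∀ u v, G.Adj u v ↔ u ≠ v ∧ R (f u) (f v))
    (hH : ∀ u v, H.Adj u v ↔ u ≠ v ∧ R (g u) (g v))
    (hcard : ∀ a, (Finset.univ.filter fun v => f v = a).card
      = (Finset.univ.filter fun v => g v = a).card) : Nonempty (G ≃g H) := by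
  have heq : ∀ a, Nonempty ({v // f v = a} ≃ {v // g v = a}) := fun a => by
    rw [← Fintype.card_eq, Fintype.card_subtype, Fintype.card_subtype, hcard]
  let e : V ≃ W := (Equiv.sigmaFiberEquiv f).symm.trans
    ((Equiv.sigmaCongrRight fun a => (heq a).some).trans (Equiv.sigmaFiberEquiv g))
  have he : ∀ v, g (e v) = f v := fun v => ((heq (f v)).some ⟨v, rfl⟩).2
  exact ⟨⟨e, by intro u v; rw [hH, hG, he, he, e.injective.ne_iff]⟩⟩


/-- Supplies the least part size `δ + 1 - s` used when `s < δ`. -/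
theorem minDegree_lt_partSize_add {V ι : Type*} [Fintype V] [DecidableEq ι] (G : SimpleGraph V)
    [DecidableRel G.Adj] (c : V → Option ι) (hc : ∀ u v, G.Adj u v → Compat (c u) (c v)) (C : ι)
    (hC : 1 ≤ partSize c (some C)) :
    G.minDegree + 1 ≤ partSize c none + partSize c (some C) := by
  classical
  obtain ⟨v, hv⟩ := Finset.card_pos.1 hC
  have hvC : c v = some C := (Finset.mem_filter.1 hv).2
  have h1 : G.neighborFinset v ⊆ (Finset.univ.filter fun u => c u = none) ∪
      (Finset.univ.filter fun u => c u = some C).erase v := by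
    intro u hu
    rw [mem_neighborFinset] at hu
    have := hc v u hu
    rw [hvC] at this
    rcases this with h | h | h
    · simp at h
    · simp [h]
    · simp [← h, hu.ne']
  have h2 := (Finset.card_le_card h1).trans (Finset.card_union_le _ _)
  rw [Finset.card_erase_of_mem hv, card_neighborFinset_eq_degree] at h2
  have h3 := G.minDegree_le_degree v
  unfold partSize at hC ⊢
  omega

/-- A full join of `δ` vertices with `δ` isolated vertices and one clique is extremal. -/
theorem nonempty_iso_extremalGraph {V ι : Type*} [Fintype V] [Fintype ι] [DecidableEq ι]
    (G : SimpleGraph V) (c : V → Option ι) (δ : ℕ)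
    (hn : 2 * δ ≤ Fintype.card V) (hs : partSize c none = δ) (C₀ : ι)
    (hC₀ : partSize c (some C₀) = Fintype.card V - 2 * δ)
    (hC : ∀ C, C ≠ C₀ → partSize c (some C) = 1)
    (hadj : ∀ u v, G.Adj u v ↔ u ≠ v ∧ Compat (c u) (c v)) :
    Nonempty (G ≃g extremalGraph (Fintype.card V) δ) := by
  classical
  set n := Fintype.card V with hndef
  let f : V → Option Bool := fun v => (c v).map fun C => decide (C = C₀)
  let g : Fin δ ⊕ (Fin (n - 2 * δ) ⊕ Fin δ) → Option Bool :=
    Sum.elim (fun _ => none) (Sum.elim (fun _ => some true) fun _ => some false)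
  have hfnone : ∀ v, f v = none ↔ c v = none := fun v => by simp [f]
  have hftrue : ∀ v, f v = some true ↔ c v = some C₀ := fun v => by simp [f]
  have h1 : (Finset.univ.filter fun v => f v = none).card = δ := by
    simp only [hfnone]; exact hs
  have h2 : (Finset.univ.filter fun v => f v = some true).card = n - 2 * δ := by
    simp only [hftrue]; exact hC₀
  have h3 : (Finset.univ.filter fun v => f v = some false).card = δ := by
    have h4 := Finset.card_eq_sum_card_fiberwise (f := f) (s := Finset.univ)
      (t := Finset.univ) (fun _ _ => Finset.mem_coe.2 (Finset.mem_univ _))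
    rw [Fintype.sum_option, Fintype.sum_bool, h1, h2, Finset.card_univ, ← hndef] at h4
    omega
  refine nonempty_iso_of_coloring G _ (fun a b => a = none ∨ b = none ∨ a = some true ∧ b = some true)
    f g ?_ ?_ ?_
  · intro u v
    rw [hadj, hfnone, hfnone, hftrue, hftrue]
    refine and_congr_right fun huv => ⟨?_, ?_⟩
    · rintro (h | h | h)
      · exact Or.inl h
      · exact Or.inr (Or.inl h)
      · rcases hu : c u with _ | C
        · exact Or.inl rfl
        · by_cases hCC : C = C₀
          · subst hCC; exact Or.inr (Or.inr ⟨rfl, by rw [← h, hu]⟩)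
          · exact absurd (Finset.card_le_one.1 (hC C hCC).le u (by simp [hu]) v
              (by simp [← h, hu])) huv
    · rintro (h | h | h)
      · exact Or.inl h
      · exact Or.inr (Or.inl h)
      · exact Or.inr (Or.inr (h.1.trans h.2.symm))
  · rintro (u | u | u) (v | v | v) <;> simp [extremalGraph, graphJoin, g]
  · rintro (_ | _ | _)
    · rw [h1, Finset.card_filter, Fintype.sum_sum_type, Fintype.sum_sum_type]; simp [g]
    · rw [h3, Finset.card_filter, Fintype.sum_sum_type, Fintype.sum_sum_type]; simp [g]
    · rw [h2, Finset.card_filter, Fintype.sum_sum_type, Fintype.sum_sum_type]; simp [g]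

/-! ### Combining the partition with the spectral bound -/

/-- On a graph of large spectral radius, a separating set with many components makes the graph
extremal. -/
theorem nonempty_iso_extremalGraph_of_partition {V ι : Type*} [Fintype V] [Fintype ι]
    [DecidableEq ι] (G : SimpleGraph V) [DecidableRel G.Adj] (hconn : G.Connected) (n δ : ℕ)
    (hn : Fintype.card V = n) (hδ : 0 < δ) (hnδ : 8 * δ + 4 ≤ n) (hdeg : δ ≤ G.minDegree)
    (hρ : (extremalGraph n δ).adjSpectralRadius ≤ G.adjSpectralRadius) (c : V → Option ι)
    (hc : ∀ u v, G.Adj u v → Compat (c u) (c v)) (hpos : ∀ C, 1 ≤ partSize c (some C))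
    (hs : 1 ≤ partSize c none)
    (hcard : partSize c none + 1 ≤ Fintype.card ι ∨
      Fintype.card ι = partSize c none ∧ ∀ C, partSize c (some C) = 1) :
    Nonempty (G ≃g extremalGraph n δ) := by
  have hδ' : (1 : ℝ) ≤ δ := by exact_mod_cast hδ
  have hnδ' : 8 * (δ : ℝ) + 4 ≤ n := by exact_mod_cast hnδ
  obtain ⟨η, hη, hηδ, heq⟩ := exists_excess n δ hδ' hnδ'
  have hρL := (adjSpectralRadius_extremalGraph_ge n δ hδ hnδ η hη heq).trans hρ
  have hsum := sum_partSize c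
  rw [hn] at hsum
  have hjoin := G.join_of_le_adjSpectralRadius hconn c hc ((n : ℝ) - δ + η) hs
  have hdegC : ∀ C, δ + 1 ≤ partSize c none + partSize c (some C) := fun C =>
    (Nat.add_le_add_right hdeg 1).trans (G.minDegree_lt_partSize_add c hc C (hpos C))
  set s := partSize c none with hsdef
  have hs1 : (1 : ℝ) ≤ s := by exact_mod_cast hs
  set m : ι → ℝ := fun C => ((partSize c (some C) : ℕ) : ℝ) with hm
  have hN : ∑ C, m C = n - s := by linarith
  have hm1 : ∀ C, 1 ≤ m C := fun C => Nat.one_le_cast.2 (hpos C)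
  rcases lt_or_ge s δ with hsδ | hsδ
  · exfalso
    -- Singleton parts would force `s ≥ δ` by the minimum degree.
    have hcard' : s + 1 ≤ Fintype.card ι := by
      rcases hcard with h | ⟨h, h1⟩
      · exact h
      · obtain ⟨C⟩ := Fintype.card_pos_iff.1 (by omega : 0 < Fintype.card ι)
        have := hdegC C
        rw [h1] at this
        omega
    have hcard'' : (s : ℝ) + 1 ≤ Fintype.card ι := by exact_mod_cast hcard'
    have hsδ' : (s : ℝ) + 1 ≤ δ := by exact_mod_cast hsδ
    have hmh : ∀ C, (δ : ℝ) + 1 - s ≤ m C := fun C => by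
      have : (δ : ℝ) + 1 ≤ s + (partSize c (some C) : ℕ) := by
        exact_mod_cast hdegC C
      change _ ≤ ((partSize c (some C) : ℕ) : ℝ)
      linarith
    have hsh : ((s : ℝ) + 1) * (δ + 1 - s) ≤ n - s := by
      have h1 := Finset.card_nsmul_le_sum Finset.univ m _ fun C _ => hmh C
      rw [hN, nsmul_eq_mul, Finset.card_univ] at h1
      exact (mul_le_mul_of_nonneg_right hcard'' (by linarith)).trans h1
    have hh1 : (δ : ℝ) + 1 - s ≤ s * (δ + 1 - s) :=
      le_mul_of_one_le_left (by linarith) hs1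
    obtain ⟨hle, hbound, -⟩ := sum_div_sub_le m (δ + 1 - s) (n - δ + η) s (by linarith)
      (by linarith) hmh hcard'' (by linarith)
    rw [hN] at hle hbound
    have hineq := excess_ineq_of_lt n δ s η (by linarith) hnδ' hη heq
      (by
        rcases hs.eq_or_lt with h | h
        · left; exact_mod_cast h.symm
        · right; exact_mod_cast h) hsδ' (by linarith)
    have hlt := (mul_le_mul_of_nonneg_left hbound (by linarith : (0 : ℝ) ≤ s)).trans_lt hineq
    exact hlt.ne (hjoin (fun C => (hle C).trans_lt (by linarith)) hlt.le hρL).1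
  · have hsδ' : (δ : ℝ) ≤ s := by exact_mod_cast hsδ
    rcases hcard with hcard | ⟨hcard, hone⟩
    · have hcard' : (s : ℝ) + 1 ≤ Fintype.card ι := by exact_mod_cast hcard
      have hsn : (s : ℝ) + 1 ≤ n - s := by
        have h1 := Finset.card_nsmul_le_sum Finset.univ m _ fun C _ => hm1 C
        rw [hN, nsmul_eq_mul, Finset.card_univ] at h1
        linarith
      obtain ⟨hle, hbound, heqb⟩ := sum_div_sub_le m 1 (n - δ + η) s (by linarith)
        one_pos hm1 hcard' (by linarith)
      rw [hN, show (n : ℝ) - s - s * 1 = n - 2 * s by ring] at hle hbound heqb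
      have hmul := mul_le_mul_of_nonneg_left hbound (by linarith : (0 : ℝ) ≤ s)
      rcases hsδ.lt_or_eq with hlt | hseq
      · exfalso
        have hineq := excess_ineq_of_gt n δ s η hδ' hnδ' hη hηδ heq (by exact_mod_cast hlt)
          (by linarith)
        have hlt := hmul.trans_lt hineq
        exact hlt.ne (hjoin (fun C => (hle C).trans_lt (by linarith)) hlt.le hρL).1
      · have hseq' : (s : ℝ) = δ := by exact_mod_cast hseq.symm
        -- With `s = δ` this is the cubic for `η`, cleared of denominators.
        have hcubic : (s : ℝ) * (s * (1 / (n - δ + η - 1)) +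
            (n - 2 * s) / (n - δ + η - (n - 2 * s))) = n - δ + η - s := by
          rw [hseq', show (n : ℝ) - δ + η - (n - 2 * δ) = η + δ by ring]
          have h1 : η + δ ≠ 0 := by linarith
          obtain ⟨y, hy⟩ : ∃ y, y = (n : ℝ) - δ + η - 1 := ⟨_, rfl⟩
          have h2 : y ≠ 0 := by linarith
          rw [← hy] at heq ⊢
          obtain hn' : (n : ℝ) = y + 1 + δ - η := by linarith
          rw [hn'] at heq ⊢
          field_simp
          linear_combination -heq
        obtain ⟨hj, hadj⟩ := hjoin (fun C => (hle C).trans_lt (by linarith))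
          (hmul.trans_eq hcubic) hρL
        obtain ⟨hcι, hmC⟩ := heqb (mul_left_cancel₀ (by linarith : (s : ℝ) ≠ 0)
          (hj.trans hcubic.symm))
        obtain ⟨C₀, hC₀⟩ : ∃ C, m C = n - 2 * s := by
          by_contra! hcon
          have h1 : ∀ C, m C = 1 := fun C => (hmC C).resolve_right (hcon C)
          have h2 : ∑ C, m C = s + 1 := by simp [h1, hcι]
          linarith
        subst hn
        refine nonempty_iso_extremalGraph G c δ (by omega) hseq.symm C₀ ?_ ?_
          (fun u v => ⟨fun h => ⟨h.ne, hc u v h⟩, fun h => hadj u v h.1 h.2⟩)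
        · have h1 : ((partSize c (some C₀) + 2 * δ : ℕ) : ℝ) = (Fintype.card V : ℕ) := by
            push_cast
            change m C₀ + _ = _
            rw [hC₀, hseq']; ring
          have h2 : partSize c (some C₀) + 2 * δ = Fintype.card V := by exact_mod_cast h1
          omega
        · intro C hC
          have h1 : ∑ C, (m C - 1) = m C₀ - 1 := by
            rw [Finset.sum_sub_distrib, hN, hC₀]
            simp [hcι]; ring
          rw [← Finset.add_sum_erase _ _ (Finset.mem_univ C₀)] at h1
          have h2 := (Finset.sum_eq_zero_iff_of_nonneg fun C _ => sub_nonneg.2 (hm1 C)).1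
            (by linarith : ∑ C ∈ Finset.univ.erase C₀, (m C - 1) = 0) C
            (Finset.mem_erase.2 ⟨hC, Finset.mem_univ C⟩)
          have h3 : m C = 1 := by linarith
          exact Nat.cast_eq_one.1 h3
    · exfalso
      have hm1' : ∀ C, m C = 1 := fun C => by simp [hm, hone]
      have hn2 : (n : ℝ) = 2 * s := by
        have : ∑ C, m C = s := by simp [hm1', hcard]
        linarith
      -- Since `n = 2s`, the big-part term is zero, and `s = n/2 > δ`.
      have hineq := excess_ineq_of_gt n δ s η hδ' hnδ' hη hηδ heq (by linarith) hn2.ge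
      have hval : ∑ C, m C / (n - δ + η - m C) = s * (1 / (n - δ + η - 1)) +
          (n - 2 * s) / (n - δ + η - (n - 2 * s)) := by
        rw [Finset.sum_congr rfl fun C _ => by rw [hm1' C]]
        simp [hcard, hn2]
      rw [← hval] at hineq
      refine hineq.ne (hjoin (fun C => ?_) hineq.le hρL).1
      change m C < _
      rw [hm1']
      linarith

end SimpleGraph

theorem mainTheorem2 {V : Type*} [Fintype V] (G : SimpleGraph V) [DecidableRel G.Adj]
    (hconn : G.Connected) (n δ k d : ℕ) (hn : Fintype.card V = n)
    (hδ : 0 < δ) (hnδ : 8 * δ + 4 ≤ n) (hdeg : δ ≤ G.minDegree)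
    (hk : 3 ≤ k) (hkodd : Odd k) (hd : 1 ≤ d) (hdk : d < k) (hnd : n ≡ d [MOD 2])
    (hρ : (SimpleGraph.extremalGraph n δ).adjSpectralRadius ≤ G.adjSpectralRadius) :
    G.IsKDCritical k d ↔ ¬ Nonempty (G ≃g SimpleGraph.extremalGraph n δ) := by
  refine ⟨fun h ⟨e⟩ => G.not_isKDCritical_of_iso_extremalGraph n δ k d hδ hd hdk e h, fun h => ?_⟩
  by_contra hcrit
  obtain ⟨ι, _, _, c, hc, hpos, hs, hcard⟩ :=
    G.exists_partition_of_not_isKDCritical hconn (by omega) k d hkodd hd hdk (hn ▸ hnd) hcrit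
  exact h (G.nonempty_iso_extremalGraph_of_partition hconn n δ hn hδ hnδ hdeg hρ c hc hpos hs hcard)
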